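/- Let $h:\mathbb{C}\setminus\mathbb{R}\to\mathbb{C}$ be a Herglotz--Nevanlinna function, i.e. $h$ is analytic, $h(\overline{\zeta})=\overline{h(\zeta)}$, and $\operatorname{Im}h(\zeta)\ge 0$ for $\operatorname{Im}\zeta>0$. Let $\operatorname{dom}(h)\supseteq\mathbb{C}\setminus\mathbb{R}$ be its maximal domain of analyticity (all points near which $h$, off the real line, agrees with a function analytic at the point), and denote the continuation of $h$ to $\operatorname{dom}(h)$ again by $h$. Let $\mathcal{L}(h)$ be the Herglotz space of $h$, i.e. the reproducing kernel Hilbert space of functions on $\operatorname{dom}(h)$ with kernel $$N_h(\zeta,w)=\frac{h(\zeta)-\overline{h(w)}}{\zeta-\overline{w}}\quad(\zeta\ne\overline{w}),\qquad N_h(w,\overline{w})=h'(w).$$ For a function $f$ on $\operatorname{dom}(h)$ put $D_w(f)(\zeta)=\frac{f(\zeta)-f(w)}{\zeta-w}$, with $D_w(f)(w)=f'(w)$. A linear relation on $\mathcal{L}(h)$ is a linear subspace $B\subseteq\mathcal{L}(h)\times\mathcal{L}(h)$. Its resolvent set $\varrho(B)$ consists of all $w\in\mathbb{C}$ for which $(B-w)^{-1}=\{(k-wf,f):(f,k)\in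 B\}$ is (the graph of) an everywhere defined bounded operator, and $\sigma(B)=\mathbb{C}\setminus\varrho(B)$. The essential spectrum $\sigma_{ess}(B)$ is the set of those points of $\sigma(B)$ that are not isolated eigenvalues of finite algebraic multiplicity; here an eigenvalue $w$ of $B$ is isolated if it is an isolated point of $\sigma(B)$, and its algebraic multiplicity is the rank of its Riesz projection $-\frac{1}{2\pi i}\oint (B-z)^{-1}\,dz$, taken over a small circle around $w$. Let $S_h=\{(f,k)\in\mathcal{L}(h)\times\mathcal{L}(h): k(\zeta)=\zeta f(\zeta)\}$ be the multiplication operator by the independent variable, and let $$A_h=\{(f,k)\in\mathcal{L}(h)\times\mathcal{L}(h): k(\zeta)-\zeta f(\zeta)\text{ is constant}\},$$ which is the self-adjoint extension of $S_h$ with $(A_h-w)^{-1}=D_w$. Let $\mathcal{M}(h)$ be the set of all analytic $g:\operatorname{dom}(h)\to\mathbb{C}$ such that $D_w(g)\in\mathcal{L}(h)$ for all $w\in\operatorname{dom}(h)$. **Theorem.** Let $g\in\mathcal{M}(h)\setminus\{0\}$ and let $\tilde{A}$ be the regular extension of $S_h$ defined by $g$, that is, a closed linear relation $\tilde{A}\supseteq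 S_h$ with $\varrho(\tilde{A})\neq\emptyset$ such that every $w\in\operatorname{dom}(h)$ with $g(w)\ne 0$ belongs to $\varrho(\tilde{A})$ and $$(\tilde{A}-w)^{-1}f=D_w(f)-\frac{f(w)}{g(w)}\,D_w(g)\qquad(f\in\mathcal{L}(h)).$$ Then $$\sigma_{ess}(A_h)\cap\mathbb{R}=\sigma_{ess}(\tilde{A})\cap\mathbb{R}.$$ Moreover, if $g$ vanishes identically neither on $\mathbb{C}^+$ nor on $\mathbb{C}^-$, then $$\sigma_{ess}(A_h)=\sigma_{ess}(\tilde{A}).$$ -/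

import Mathlib

open scoped ComplexConjugate Topology

noncomputable section

/-! ### Linear relations on a Hilbert space, their resolvents and spectra -/

namespace LinearRelation

variable {H : Type*} [NormedAddCommGroup H] [InnerProductSpace ℂ H]

/-- The bounded operator `T` is the inverse relation `(A - w)⁻¹`, i.e. `(A - w)⁻¹`, which consists
of the pairs `(f, x)` with `(x, f) ∈ A - w`, is the graph of `T`. -/
def IsResolventAt (A : Submodule ℂ (H × H)) (w : ℂ) (T : H →L[ℂ] H) : Prop :=
  ∀ f x : H, (x, f + w • x) ∈ A ↔ x = T f

/-- The resolvent set of a linear relation: all `w` such that `(A - w)⁻¹` is an everywhere defined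
bounded operator. -/
def resolventSet (A : Submodule ℂ (H × H)) : Set ℂ :=
  {w | ∃ T : H →L[ℂ] H, IsResolventAt A w T}

open Classical in
/-- The resolvent `(A - w)⁻¹` (with value `0` outside the resolvent set). -/
def resolvent (A : Submodule ℂ (H × H)) (w : ℂ) : H →L[ℂ] H :=
  if hw : ∃ T : H →L[ℂ] H, IsResolventAt A w T then hw.choose else 0

/-- The spectrum of a linear relation. -/
def spectrum (A : Submodule ℂ (H × H)) : Set ℂ := (resolventSet A)ᶜ

/-- `w` is an eigenvalue of the linear relation `A`. -/
def IsEigenvalue (A : Submodule ℂ (H × H)) (w : ℂ) : Prop :=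
  ∃ x : H, x ≠ 0 ∧ (x, w • x) ∈ A

/-- The Riesz projection `-(2πi)⁻¹ ∮ (A - z)⁻¹ dz`, integrated over the circle of radius `r`
around `w`. -/
def rieszProjection (A : Submodule ℂ (H × H)) (w : ℂ) (r : ℝ) : H →L[ℂ] H :=
  -(2 * (Real.pi : ℂ) * Complex.I)⁻¹ • ∮ z in C(w, r), resolvent A z

/-- `w` is an isolated eigenvalue of finite algebraic multiplicity: an eigenvalue which is an
isolated point of the spectrum, and whose Riesz projection (taken over a circle that separates `w`
from the rest of the spectrum) has finite rank. -/
def IsIsolatedEigenvalueOfFiniteMultiplicity (A : Submodule ℂ (H × H)) (w : ℂ) : Prop :=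
  IsEigenvalue A w ∧ ∃ r : ℝ, 0 < r ∧ Metric.closedBall w r ∩ spectrum A = {w} ∧
    FiniteDimensional ℂ (rieszProjection A w r).range

/-- The essential spectrum: the spectrum without the isolated eigenvalues of finite algebraic
multiplicity. -/
def essentialSpectrum (A : Submodule ℂ (H × H)) : Set ℂ :=
  spectrum A \ {w | IsIsolatedEigenvalueOfFiniteMultiplicity A w}

/-- A regular extension of `S`: a closed linear relation that contains `S` and has a nonempty
resolvent set. -/
structure IsRegularExtension (S A : Submodule ℂ (H × H)) : Prop where
  isClosed : IsClosed (A : Set (H × H))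
  le : S ≤ A
  nonempty_resolventSet : (resolventSet A).Nonempty

end LinearRelation

/-! ### Herglotz-Nevanlinna functions and Herglotz spaces -/

/-- `h` is a Herglotz-Nevanlinna function on `ℂ \ ℝ` (its values at real points are irrelevant). -/
structure IsHerglotzNevanlinna (h : ℂ → ℂ) : Prop where
  analyticOnNhd : AnalyticOnNhd ℂ h {z | z.im ≠ 0}
  map_conj : ∀ z : ℂ, z.im ≠ 0 → h (conj z) = conj (h z)
  im_nonneg : ∀ z : ℂ, 0 < z.im → 0 ≤ (h z).im

/-- The maximal domain of analyticity of a function `h` on `ℂ \ ℝ`: all points near which `h`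
agrees, off the real line, with a function analytic at the point. -/
def herglotzDom (h : ℂ → ℂ) : Set ℂ :=
  {z | ∃ F : ℂ → ℂ, AnalyticAt ℂ F z ∧ ∀ᶠ ζ in 𝓝 z, ζ.im ≠ 0 → F ζ = h ζ}

open Classical in
/-- The analytic continuation of `h` from `ℂ \ ℝ` to `herglotzDom h`. -/
def herglotzExt (h : ℂ → ℂ) (z : ℂ) : ℂ :=
  if z.im ≠ 0 then h z else Filter.limUnder (𝓝[{ζ : ℂ | ζ.im ≠ 0}] z) h

open Classical in
/-- The Nevanlinna kernel `(h(ζ) - conj h(w)) / (ζ - conj w)`, with the value `h'(ζ)` if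
`ζ = conj w`. -/
def nevanlinnaKernel (h : ℂ → ℂ) (ζ w : ℂ) : ℂ :=
  if ζ = conj w then deriv (herglotzExt h) ζ
  else (herglotzExt h ζ - conj (herglotzExt h w)) / (ζ - conj w)

/-- Extension by zero of a function on `D ⊆ ℂ` to all of `ℂ`. -/
def extendZero {D : Set ℂ} (f : D → ℂ) : ℂ → ℂ :=
  Function.extend Subtype.val f 0

/-- The difference quotient `D_w(f)(ζ) = (f(ζ) - f(w)) / (ζ - w)`, with the value `f'(w)` at
`ζ = w`. -/
def diffQuot {D : Set ℂ} (f : D → ℂ) (w : D) : D → ℂ :=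
  fun ζ => dslope (extendZero f) w ζ

section HerglotzSpace

variable (h : ℂ → ℂ) (H : Type*) [NormedAddCommGroup H] [InnerProductSpace ℂ H]
  [RKHS ℂ H (herglotzDom h) ℂ]

/-- The Hilbert space `H` of functions on `herglotzDom h` is the Herglotz space `𝓛(h)`, that is,
the reproducing kernel Hilbert space whose kernel is the Nevanlinna kernel of `h`. -/
def IsHerglotzSpace [CompleteSpace H] : Prop :=
  ∀ ζ w : herglotzDom h, RKHS.kernel H ζ w 1 = nevanlinnaKernel h ζ w

/-- The (graph of the) operator `S_h` of multiplication by the independent variable, with domain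
`{f ∈ 𝓛(h) | ζ f(ζ) ∈ 𝓛(h)}`. -/
def mulRelation : Submodule ℂ (H × H) where
  carrier := {p | ∀ ζ : herglotzDom h, p.2 ζ = (ζ : ℂ) * p.1 ζ}
  add_mem' := by
    intro a b ha hb ζ
    simp [ha ζ, hb ζ, mul_add]
  zero_mem' := by
    intro ζ
    simp
  smul_mem' := by
    intro c a ha ζ
    simp [ha ζ, mul_left_comm]

/-- The self-adjoint extension `A_h` of `S_h`, consisting of all pairs `(f, k)` such that
`k(ζ) - ζ f(ζ)` is constant. -/
def selfAdjointRelation : Submodule ℂ (H × H) where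
  carrier := {p | ∃ c : ℂ, ∀ ζ : herglotzDom h, p.2 ζ - (ζ : ℂ) * p.1 ζ = c}
  add_mem' := by
    rintro a b ⟨c, hc⟩ ⟨d, hd⟩
    refine ⟨c + d, fun ζ => ?_⟩
    rw [← hc ζ, ← hd ζ]
    simp
    ring
  zero_mem' := ⟨0, fun ζ => by simp⟩
  smul_mem' := by
    rintro s a ⟨c, hc⟩
    refine ⟨s * c, fun ζ => ?_⟩
    rw [← hc ζ]
    simp
    ring

/-- The space `𝓜(h)` of all analytic functions `g` on `herglotzDom h` such that `D_w(g) ∈ 𝓛(h)`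
for all `w`. -/
def quasiHerglotzSpace : Set (herglotzDom h → ℂ) :=
  {g | AnalyticOnNhd ℂ (extendZero g) (herglotzDom h) ∧
    ∀ w : herglotzDom h, ∃ F : H, ⇑F = diffQuot g w}

variable {h H}

/-- The linear relation `A` is defined by `g`: for all `w` with `g(w) ≠ 0`, the point `w` lies in
the resolvent set of `A`, and `(A - w)⁻¹ f = D_w(f) - (f(w) / g(w)) D_w(g)` for all `f`. -/
def IsDefinedBy (A : Submodule ℂ (H × H)) (g : herglotzDom h → ℂ) : Prop :=
  ∀ w : herglotzDom h, g w ≠ 0 → (w : ℂ) ∈ LinearRelation.resolventSet A ∧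
    ∀ f : H, ⇑(LinearRelation.resolvent A w f) = diffQuot (⇑f) w - (f w / g w) • diffQuot g w

end HerglotzSpace

end

/-! For nonreal `z` with `g z ≠ 0`, the resolvents of `A_h` and of the extension differ by the rank
one operator `f ↦ (f z / g z) D_z g`. The essential spectrum should not see such a perturbation,
provided the perturbation is meromorphic in `z` near the point `w` in question, which need not lie
in the domain of `h`.

Two facts translate the problem. Off the essential spectrum the resolvent is finitely meromorphic:
analytic plus a meromorphic part with values in one finite dimensional space
(`finitelyMeromorphicAt_resolvent`). Conversely, if the resolvent of a closed relation has a
finitely meromorphic extension to `w`, then `w` is not in the essential spectrum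
(`notMem_essentialSpectrum`). Meromorphic rank one terms are finitely meromorphic, so they can be
added freely.

Meromorphy at `w` comes from writing `f z`, `g z` and `D_z g` through the known resolvent at `z` and
data at one fixed point `z₀`. Passing from `A_h` to the extension requires dividing by `g`, so `g`
must not vanish identically at nonreal points near `w`. At real `w` one half-plane on which `g ≢ 0`
suffices; at nonreal `w` it must be the half-plane of `w`. In the other direction nothing is needed,
because zeros of `g` are eigenvalues of the extension. -/

open Filter Set

/-! ### Finitely meromorphic operator functions -/

section Meromorphic

variable {E F : Type*} [NormedAddCommGroup E] [NormedSpace ℂ E]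
  [NormedAddCommGroup F] [NormedSpace ℂ F]

/-- A continuous linear map applied to a meromorphic function is meromorphic. -/
theorem ContinuousLinearMap.comp_meromorphicAt (L : E →L[ℂ] F) {f : ℂ → E} {x : ℂ}
    (hf : MeromorphicAt f x) : MeromorphicAt (fun z => L (f z)) x := by
  obtain ⟨n, hn⟩ := hf
  refine ⟨n, ?_⟩
  have := (L.analyticAt _).comp hn
  refine this.congr (Eventually.of_forall fun z => ?_)
  simp

/-- Taylor expansion of order `N`: a polynomial with coefficients in a finite dimensional space plus
a remainder divisible by `(z - x) ^ N`. -/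
theorem AnalyticAt.exists_taylor [CompleteSpace E] {f : ℂ → E} {x : ℂ} (hf : AnalyticAt ℂ f x)
    (N : ℕ) : ∃ (V : Submodule ℂ E) (p r : ℂ → E), FiniteDimensional ℂ V ∧ AnalyticAt ℂ p x ∧
      AnalyticAt ℂ r x ∧ (∀ z, p z ∈ V) ∧ ∀ z, f z = p z + (z - x) ^ N • r z := by
  induction N with
  | zero =>
    exact ⟨⊥, 0, f, inferInstance, analyticAt_const, hf, by simp, by simp⟩
  | succ N ih =>
    obtain ⟨V, p, r, hV, hp, hr, hpV, h⟩ := ih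
    refine ⟨V ⊔ Submodule.span ℂ {r x}, fun z => p z + (z - x) ^ N • r x, dslope r x,
      inferInstance, by fun_prop, ?_, fun z => ?_, fun z => ?_⟩
    · obtain ⟨q, hq⟩ := hr
      exact ⟨_, hq.has_fpower_series_dslope_fslope⟩
    · exact Submodule.add_mem_sup (hpV z)
        (Submodule.smul_mem _ _ (Submodule.mem_span_singleton_self _))
    · have := sub_smul_dslope r x z
      rw [h z, pow_succ, mul_smul, this, smul_sub]
      module

end Meromorphic

section FinitelyMeromorphic

variable {H : Type*} [NormedAddCommGroup H] [NormedSpace ℂ H]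

/-- An operator function is finitely meromorphic at `x` if near `x` it is the sum of an analytic
function and of a meromorphic function with values in the operators whose range lies in a fixed
finite dimensional space. -/
def FinitelyMeromorphicAt (R : ℂ → H →L[ℂ] H) (x : ℂ) : Prop :=
  ∃ (F K : ℂ → H →L[ℂ] H) (V : Submodule ℂ H), FiniteDimensional ℂ V ∧ AnalyticAt ℂ F x ∧
    MeromorphicAt K x ∧ (∀ z f, K z f ∈ V) ∧ ∀ᶠ z in 𝓝[≠] x, R z = F z + K z

namespace FinitelyMeromorphicAt

variable {R S : ℂ → H →L[ℂ] H} {x : ℂ}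

theorem _root_.AnalyticAt.finitelyMeromorphicAt (hR : AnalyticAt ℂ R x) :
    FinitelyMeromorphicAt R x :=
  ⟨R, 0, ⊥, inferInstance, hR, MeromorphicAt.const 0 x, by simp, by simp⟩

theorem meromorphicAt (hR : FinitelyMeromorphicAt R x) : MeromorphicAt R x := by
  obtain ⟨F, K, V, -, hF, hK, -, h⟩ := hR
  exact (hF.meromorphicAt.add hK).congr (h.mono fun z hz => hz.symm)

theorem congr (hR : FinitelyMeromorphicAt R x) (h : ∀ᶠ z in 𝓝[≠] x, R z = S z) :
    FinitelyMeromorphicAt S x := by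
  obtain ⟨F, K, V, hV, hF, hK, hKV, h'⟩ := hR
  exact ⟨F, K, V, hV, hF, hK, hKV, by filter_upwards [h, h'] with z h1 h2; rw [← h1, h2]⟩

theorem add (hR : FinitelyMeromorphicAt R x) (hS : FinitelyMeromorphicAt S x) :
    FinitelyMeromorphicAt (fun z => R z + S z) x := by
  obtain ⟨F, K, V, hV, hF, hK, hKV, h⟩ := hR
  obtain ⟨F', K', V', hV', hF', hK', hKV', h'⟩ := hS
  refine ⟨fun z => F z + F' z, fun z => K z + K' z, V ⊔ V', inferInstance, hF.fun_add hF', hK.add hK',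
    fun z f => Submodule.add_mem_sup (hKV z f) (hKV' z f), ?_⟩
  filter_upwards [h, h'] with z h1 h2
  rw [h1, h2]
  abel

/-- A meromorphic function with values in the operators of rank one is finitely meromorphic. -/
theorem smulRight [CompleteSpace H] {φ : ℂ → H →L[ℂ] ℂ} {u : ℂ → H} (hφ : MeromorphicAt φ x)
    (hu : MeromorphicAt u x) : FinitelyMeromorphicAt (fun z => (φ z).smulRight (u z)) x := by
  obtain ⟨n, hn⟩ := hφ
  obtain ⟨m, hm⟩ := hu
  -- The poles of `φ` and `u` have orders at most `n` and `m`, so a remainder of order `n + m` in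
  -- `(z - x) ^ m • u z` cancels both and gives an analytic term.
  obtain ⟨V, p, r, hV, hp, hr, hpV, h⟩ := hm.exists_taylor (n + m)
  let B := ContinuousLinearMap.smulRightL ℂ H H
  refine ⟨fun z => B ((z - x) ^ n • φ z) (r z),
    fun z => (((z - x) ^ (n + m))⁻¹ : ℂ) • B ((z - x) ^ n • φ z) (p z), V, hV,
    (B.analyticAt_bilinear _).comp₂ hn hr, ?_, fun z f => ?_, ?_⟩
  · have h1 : MeromorphicAt (fun z : ℂ => ((z - x) ^ (n + m))⁻¹) x :=
      MeromorphicAt.inv (f := fun z : ℂ => (z - x) ^ (n + m)) (by fun_prop)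
    exact h1.smul ((B.analyticAt_bilinear _).comp₂ hn hp).meromorphicAt
  · simp only [B, smul_apply, ContinuousLinearMap.smulRightL_apply_apply]
    exact V.smul_mem _ (V.smul_mem _ (hpV z))
  · filter_upwards [self_mem_nhdsWithin] with z hz
    have hz : z - x ≠ 0 := sub_ne_zero.2 hz
    have h1 : u z = ((z - x) ^ m)⁻¹ • (p z + (z - x) ^ (n + m) • r z) := by
      rw [← h z, inv_smul_smul₀ (pow_ne_zero _ hz)]
    ext f
    simp only [B, smul_apply, add_apply, h1,
      ContinuousLinearMap.smulRightL_apply_apply, ContinuousLinearMap.smulRight_apply]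
    match_scalars
    all_goals
      field_simp
      rw [smul_eq_mul]
      ring

end FinitelyMeromorphicAt

end FinitelyMeromorphic

/-! ### Resolvents of linear relations -/

namespace LinearRelation

section Resolvent

variable {H : Type*} [NormedAddCommGroup H] [InnerProductSpace ℂ H]
  {A : Submodule ℂ (H × H)} {w z : ℂ} {T S : H →L[ℂ] H}

theorem IsResolventAt.mem (hT : IsResolventAt A w T) (f : H) : (T f, f + w • T f) ∈ A :=
  (hT f (T f)).2 rfl

theorem IsResolventAt.unique (hT : IsResolventAt A w T) (hS : IsResolventAt A w S) : T = S := by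
  ext f
  exact (hS f (T f)).1 (hT.mem f)

theorem isResolventAt_resolvent (hw : w ∈ resolventSet A) : IsResolventAt A w (resolvent A w) := by
  have hw' : ∃ T : H →L[ℂ] H, IsResolventAt A w T := hw
  rw [resolvent, dif_pos hw']
  exact hw'.choose_spec

theorem IsResolventAt.mem_resolventSet (hT : IsResolventAt A w T) : w ∈ resolventSet A := ⟨T, hT⟩

theorem IsResolventAt.resolvent_eq (hT : IsResolventAt A w T) : resolvent A w = T :=
  (isResolventAt_resolvent hT.mem_resolventSet).unique hT

/-- The first resolvent identity. -/
theorem IsResolventAt.sub_eq (hT : IsResolventAt A w T) (hS : IsResolventAt A z S) :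
    S - T = (z - w) • (T * S) := by
  ext f
  have h : S f = T (f + (z - w) • S f) := by
    refine (hT _ _).1 ?_
    convert hS.mem f using 2
    module
  rw [map_add, map_smul] at h
  simp only [sub_apply, smul_apply]
  rw [sub_eq_iff_eq_add']
  exact h

theorem IsResolventAt.commute (hT : IsResolventAt A w T) (hS : IsResolventAt A z S) :
    T * S = S * T := by
  by_cases h : z = w
  · subst h
    rw [hT.unique hS]
  · have h1 := hT.sub_eq hS
    have h2 := hS.sub_eq hT
    have h3 : (z - w) • (T * S) = (z - w) • (S * T) := by
      rw [← h1, ← neg_sub T S, h2]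
      module
    exact smul_right_injective _ (sub_ne_zero.2 h) h3

/-- The resolvent at a point determines the resolvent at nearby points. -/
theorem IsResolventAt.of_isUnit (hT : IsResolventAt A w T)
    (h : IsUnit (1 - (z - w) • T)) :
    IsResolventAt A z (Ring.inverse (1 - (z - w) • T) * T) := by
  intro f x
  have e : f + z • x = (f + (z - w) • x) + w • x := by module
  rw [e, hT]
  have h1 : x = T (f + (z - w) • x) ↔ (1 - (z - w) • T) x = T f := by
    simp only [map_add, map_smul, sub_apply, smul_apply,
      one_apply_eq_self, sub_eq_iff_eq_add]
  rw [h1]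
  constructor
  · intro h2
    have h3 := congrArg (fun L : H →L[ℂ] H => L x) (Ring.inverse_mul_cancel _ h)
    change x = Ring.inverse (1 - (z - w) • T) (T f)
    rw [← h2]
    exact h3.symm
  · rintro rfl
    exact congrArg (fun L : H →L[ℂ] H => L (T f)) (Ring.mul_inverse_cancel _ h)

theorem eventually_mem_resolventSet [CompleteSpace H] (hw : w ∈ resolventSet A) :
    (∀ᶠ z in 𝓝 w, z ∈ resolventSet A) ∧ AnalyticAt ℂ (resolvent A) w := by
  obtain ⟨T, hT⟩ := hw
  have hc : AnalyticAt ℂ (fun z : ℂ => (1 : H →L[ℂ] H) - (z - w) • T) w := by fun_prop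
  have hu : ∀ᶠ z in 𝓝 w, IsUnit ((1 : H →L[ℂ] H) - (z - w) • T) := by
    refine hc.continuousAt.eventually (Units.isOpen.mem_nhds ?_)
    simp
  have hr : ∀ᶠ z in 𝓝 w, IsResolventAt A z (Ring.inverse (1 - (z - w) • T) * T) :=
    hu.mono fun z hz => hT.of_isUnit hz
  refine ⟨hr.mono fun z hz => hz.mem_resolventSet, ?_⟩
  have hi : AnalyticAt ℂ (fun z : ℂ => Ring.inverse ((1 : H →L[ℂ] H) - (z - w) • T)) w := by
    have h1 : AnalyticAt ℂ Ring.inverse ((1 : H →L[ℂ] H) - (w - w) • T) := by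
      simpa using analyticAt_inverse (𝕜 := ℂ) (1 : (H →L[ℂ] H)ˣ)
    exact AnalyticAt.fun_comp h1 hc
  exact (hi.mul analyticAt_const).congr (hr.mono fun z hz => hz.resolvent_eq.symm)

/-- A limit of resolvents of a closed linear relation is a resolvent. -/
theorem isResolventAt_of_tendsto (hA : IsClosed (A : Set (H × H))) {R : ℂ → H →L[ℂ] H}
    {l : Filter ℂ} [l.NeBot] (hl : l ≤ 𝓝 w) (hR : Tendsto R l (𝓝 T))
    (h : ∀ᶠ z in l, IsResolventAt A z (R z)) : IsResolventAt A w T := by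
  have hid : Tendsto (fun z : ℂ => z) l (𝓝 w) := hl
  have happ : ∀ {u : ℂ → H} {v : H}, Tendsto u l (𝓝 v) →
      Tendsto (fun z => R z (u z)) l (𝓝 (T v)) := fun hu =>
    (isBoundedBilinearMap_apply.continuous.tendsto (T, _)).comp (hR.prodMk_nhds hu)
  intro f x
  constructor
  · intro hx
    have h1 : ∀ᶠ z in l, R z (f + (w - z) • x) = x := by
      filter_upwards [h] with z hz
      refine ((hz _ _).1 ?_).symm
      convert hx using 2
      module
    have h2 : Tendsto (fun z => f + (w - z) • x) l (𝓝 f) := by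
      simpa using (tendsto_const_nhds (x := f)).add
        (((tendsto_const_nhds (x := w)).sub hid).smul_const x)
    exact tendsto_nhds_unique (tendsto_const_nhds.congr' (h1.mono fun z hz => hz.symm)) (happ h2)
  · rintro rfl
    have h1 := happ (tendsto_const_nhds (x := f))
    have h2 : Tendsto (fun z => (R z f, f + z • R z f)) l (𝓝 (T f, f + w • T f)) :=
      h1.prodMk_nhds (tendsto_const_nhds.add (hid.smul h1))
    exact hA.mem_of_tendsto h2 (h.mono fun z hz => hz.mem f)

/-- A closed relation whose resolvent has a pole at `w` has the eigenvalue `w`. -/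
theorem isEigenvalue_of_meromorphicAt [CompleteSpace H] (hA : IsClosed (A : Set (H × H)))
    {R : ℂ → H →L[ℂ] H} (hR : MeromorphicAt R w)
    (h : ∀ᶠ z in 𝓝[≠] w, IsResolventAt A z (R z)) (hw : w ∈ spectrum A) : IsEigenvalue A w := by
  -- Without a pole, `R` would have a limit at `w`, and closedness would make this limit a resolvent
  -- at `w`.
  have ho : meromorphicOrderAt R w < 0 := by
    by_contra! hn
    obtain ⟨T, hT⟩ := tendsto_nhds_of_meromorphicOrderAt_nonneg hR hn
    exact hw (isResolventAt_of_tendsto hA nhdsWithin_le_nhds hT h).mem_resolventSet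
  obtain ⟨G, hG, hG0, hRG⟩ := (meromorphicOrderAt_ne_top_iff hR).1 ho.ne_top
  obtain ⟨f, hf⟩ : ∃ f, G w f ≠ 0 := by
    by_contra! hn
    exact hG0 (by ext f; simp [hn f])
  refine ⟨G w f, hf, ?_⟩
  obtain ⟨n, hn⟩ := WithTop.ne_top_iff_exists.1 ho.ne_top
  have hn0 : n < 0 := by
    rw [← hn] at ho
    exact_mod_cast ho
  rw [← hn, WithTop.untop₀_coe] at hRG
  obtain ⟨m, rfl⟩ := Int.eq_negSucc_of_lt_zero hn0
  have hGf : Tendsto (fun z => G z f) (𝓝[≠] w) (𝓝 (G w f)) :=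
    (hG.continuousAt.clm_apply continuousAt_const).tendsto.mono_left nhdsWithin_le_nhds
  have hid : Tendsto (fun z : ℂ => z) (𝓝[≠] w) (𝓝 w) := nhdsWithin_le_nhds
  -- These pairs are `(z - w) ^ (m + 1)` times the graph elements `(R z f, f + z • R z f)`. In the
  -- limit only the leading Laurent coefficient `G w` survives, and its range consists of
  -- eigenvectors.
  have hlim : Tendsto (fun z => (G z f, (z - w) ^ (m + 1) • f + z • G z f)) (𝓝[≠] w)
      (𝓝 (G w f, w • G w f)) := by
    refine hGf.prodMk_nhds ?_
    have h1 : Tendsto (fun z : ℂ => (z - w) ^ (m + 1)) (𝓝[≠] w) (𝓝 0) := by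
      have : Tendsto (fun z : ℂ => (z - w) ^ (m + 1)) (𝓝[≠] w) (𝓝 ((w - w) ^ (m + 1))) :=
        (hid.sub_const w).pow _
      simpa using this
    simpa using (h1.smul_const f).add (hid.smul hGf)
  refine hA.mem_of_tendsto hlim ?_
  filter_upwards [h, hRG, self_mem_nhdsWithin] with z hz hz' hzw
  have hzw : z - w ≠ 0 := sub_ne_zero.2 hzw
  have h1 : G z f = (z - w) ^ (m + 1) • R z f := by
    rw [hz', smul_apply, zpow_negSucc, smul_inv_smul₀ (pow_ne_zero _ hzw)]
  rw [h1]
  have := A.smul_mem ((z - w) ^ (m + 1)) (hz.mem f)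
  simpa [Prod.smul_mk, smul_add, smul_comm z] using this

end Resolvent

end LinearRelation

/-! ### From finitely meromorphic resolvents to the essential spectrum -/

theorem Complex.dense_im_ne_zero : Dense {z : ℂ | z.im ≠ 0} := by
  intro z
  rcases le_total 0 z.im with h | h
  · refine closure_mono (s := {z : ℂ | 0 < z.im}) (fun w hw => ne_of_gt hw) ?_
    rw [Complex.closure_setOfPred_lt_im]
    exact h
  · refine closure_mono (s := {z : ℂ | z.im < 0}) (fun w hw => ne_of_lt hw) ?_
    rw [Complex.closure_setOfPred_im_lt]
    exact h

theorem ContinuousLinearMap.circleIntegral_comp_comm {E F : Type*} [NormedAddCommGroup E]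
    [NormedSpace ℂ E] [CompleteSpace E] [NormedAddCommGroup F] [NormedSpace ℂ F] [CompleteSpace F]
    (L : E →L[ℂ] F) {f : ℂ → E} {c : ℂ} {r : ℝ} (hf : CircleIntegrable f c r) :
    ∮ z in C(c, r), L (f z) = L (∮ z in C(c, r), f z) := by
  simp only [circleIntegral, ← map_smul]
  exact L.intervalIntegral_comp_comm hf.out

/-- An operator function with analytic part `F` and finite rank part with values in `V` has a circle
integral with values in `V`. -/
theorem circleIntegral_apply_mem {H : Type*} [NormedAddCommGroup H] [InnerProductSpace ℂ H]
    [CompleteSpace H] {R F : ℂ → H →L[ℂ] H} {c : ℂ} {r : ℝ} (hr : 0 ≤ r) (V : Submodule ℂ H)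
    [FiniteDimensional ℂ V] (hR : ContinuousOn R (Metric.sphere c r))
    (hF : DifferentiableOn ℂ F (Metric.closedBall c r))
    (hV : ∀ z ∈ Metric.sphere c r, ∀ f, R z f - F z f ∈ V) (f : H) :
    (∮ z in C(c, r), R z) f ∈ V := by
  have hFc : ContinuousOn F (Metric.sphere c r) :=
    hF.continuousOn.mono Metric.sphere_subset_closedBall
  have hF0 : ∮ z in C(c, r), F z = 0 :=
    Complex.circleIntegral_eq_zero_of_differentiable_on_off_countable hr countable_empty
      hF.continuousOn fun z hz => (hF z (Metric.ball_subset_closedBall hz.1)).differentiableAt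
        (Metric.closedBall_mem_nhds_of_mem hz.1)
  have hRi : CircleIntegrable R c r := hR.circleIntegrable hr
  have hFi : CircleIntegrable F c r := hFc.circleIntegrable hr
  have h1 : ∮ z in C(c, r), R z = ∮ z in C(c, r), (R z - F z) := by
    rw [circleIntegral.integral_sub hRi hFi, hF0, sub_zero]
  -- Composing with the projection onto the orthogonal complement of `V` annihilates the integrand
  -- and commutes with the integral.
  let L : (H →L[ℂ] H) →L[ℂ] (H →L[ℂ] H) := ContinuousLinearMap.mul ℂ _ (1 - V.starProjection)
  have h2 : L (∮ z in C(c, r), (R z - F z)) = 0 := by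
    rw [← L.circleIntegral_comp_comm (f := fun z => R z - F z) (hRi.sub hFi)]
    have h3 : EqOn (fun z => L (R z - F z)) (fun _ => 0) (Metric.sphere c r) := by
      intro z hz
      ext x
      have := Submodule.starProjection_eq_self_iff.2 (hV z hz x)
      change (R z x - F z x) - V.starProjection (R z x - F z x) = 0
      rw [this, sub_self]
    rw [circleIntegral.integral_congr hr h3]
    simp [circleIntegral]
  rw [h1]
  have h4 := congrArg (fun T : H →L[ℂ] H => T f) h2
  refine Submodule.starProjection_eq_self_iff.1 ?_
  exact (sub_eq_zero.1 h4).symm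

namespace LinearRelation

section Essential

variable {H : Type*} [NormedAddCommGroup H] [InnerProductSpace ℂ H] [CompleteSpace H]
  {A : Submodule ℂ (H × H)} {w : ℂ}

/-- If the resolvent of a closed relation extends finitely meromorphically to `w`, then `w` does not
belong to the essential spectrum. -/
theorem notMem_essentialSpectrum (hA : IsClosed (A : Set (H × H))) {R : ℂ → H →L[ℂ] H}
    (hR : FinitelyMeromorphicAt R w)
    (h : ∀ᶠ z in 𝓝[≠] w, z.im ≠ 0 → IsResolventAt A z (R z)) : w ∉ essentialSpectrum A := by
  rintro ⟨hw, hw'⟩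
  have hRA := hR.meromorphicAt.eventually_analyticAt
  -- Real points are limits of nonreal ones, `R` is continuous near but off `w`, and limits of
  -- resolvents of a closed relation are resolvents.
  have h' : ∀ᶠ z in 𝓝[≠] w, IsResolventAt A z (R z) := by
    filter_upwards [hRA, eventually_eventually_nhdsWithin.2 h, self_mem_nhdsWithin] with z h1 h2 h3
    rw [IsOpen.nhdsWithin_eq isOpen_compl_singleton h3] at h2
    have : (𝓝[{z : ℂ | z.im ≠ 0}] z).NeBot :=
      mem_closure_iff_nhdsWithin_neBot.1 (Complex.dense_im_ne_zero z)
    refine isResolventAt_of_tendsto (l := 𝓝[{z : ℂ | z.im ≠ 0}] z) hA nhdsWithin_le_nhds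
      (h1.continuousAt.tendsto.mono_left nhdsWithin_le_nhds) ?_
    filter_upwards [nhdsWithin_le_nhds h2, self_mem_nhdsWithin] with y h5 h6 using h5 h6
  refine hw' ⟨isEigenvalue_of_meromorphicAt hA hR.meromorphicAt h' hw, ?_⟩
  obtain ⟨F, K, V, hV, hF, hK, hKV, hRFK⟩ := hR
  have h1 := ((h'.and (hRA.and hRFK)))
  rw [eventually_nhdsWithin_iff] at h1
  obtain ⟨ε, hε, hball⟩ := Metric.eventually_nhds_iff_ball.1 (h1.and hF.eventually_analyticAt)
  have hsub : Metric.closedBall w (ε / 2) ⊆ Metric.ball w ε :=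
    Metric.closedBall_subset_ball (by linarith)
  have hsph : ∀ z ∈ Metric.sphere w (ε / 2), z ∈ Metric.ball w ε ∧ z ≠ w := fun z hz =>
    ⟨hsub (Metric.sphere_subset_closedBall hz), Metric.ne_of_mem_sphere hz (by positivity)⟩
  refine ⟨ε / 2, by positivity, ?_, ?_⟩
  · ext z
    constructor
    · rintro ⟨hz, hz'⟩
      by_contra hne
      exact hz' ((hball z (hsub hz)).1 hne).1.mem_resolventSet
    · rintro rfl
      exact ⟨Metric.mem_closedBall_self (by positivity), hw⟩
  · refine Submodule.finiteDimensional_of_le (S₂ := V) ?_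
    rintro _ ⟨f, rfl⟩
    refine V.smul_mem _ ?_
    have h2 : ∮ z in C(w, ε / 2), resolvent A z = ∮ z in C(w, ε / 2), R z :=
      circleIntegral.integral_congr (by positivity) fun z hz =>
        ((hball z (hsph z hz).1).1 (hsph z hz).2).1.resolvent_eq
    rw [h2]
    refine circleIntegral_apply_mem (F := F) (by positivity) V (fun z hz => ?_) (fun z hz => ?_)
      (fun z hz f => ?_) f
    · exact ((hball z (hsph z hz).1).1 (hsph z hz).2).2.1.continuousAt.continuousWithinAt
    · exact (hball z (hsub hz)).2.differentiableAt.differentiableWithinAt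
    · rw [((hball z (hsph z hz).1).1 (hsph z hz).2).2.2, add_apply, add_sub_cancel_left]
      exact hKV z f

end Essential

end LinearRelation

/-! ### Laurent structure of the resolvent off the essential spectrum -/

/-- A bounded operator satisfies a polynomial identity on a finite dimensional invariant
subspace. -/
theorem ContinuousLinearMap.exists_polynomial_sum_eq_zero {H : Type*} [NormedAddCommGroup H]
    [NormedSpace ℂ H] (s : H →L[ℂ] H) (V : Submodule ℂ H) [FiniteDimensional ℂ V]
    (hs : ∀ v ∈ V, s v ∈ V) :
    ∃ q : Polynomial ℂ, q ≠ 0 ∧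
      ∀ v ∈ V, ∑ i ∈ Finset.range (q.natDegree + 1), q.coeff i • (s ^ i) v = 0 := by
  let t : V →ₗ[ℂ] V := (s : H →ₗ[ℂ] H).restrict hs
  refine ⟨t.charpoly, t.charpoly_monic.ne_zero, fun v hv => ?_⟩
  have h1 := t.aeval_self_charpoly
  rw [Polynomial.aeval_eq_sum_range] at h1
  have h2 := congrArg (fun L : V →ₗ[ℂ] V => (L ⟨v, hv⟩ : H)) h1
  have h3 : ∀ i : ℕ, ((t ^ i) ⟨v, hv⟩ : H) = (s ^ i) v := by
    intro i
    induction i with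
    | zero => simp
    | succ i ih =>
      rw [pow_succ', pow_succ']
      change s ((t ^ i) ⟨v, hv⟩ : H) = s ((s ^ i) v)
      rw [ih]
  simpa [LinearMap.sum_apply, h3] using h2

namespace LinearRelation

section Laurent

variable {H : Type*} [NormedAddCommGroup H] [InnerProductSpace ℂ H] [CompleteSpace H]
  {A : Submodule ℂ (H × H)} {w : ℂ}

/-- The part of the resolvent on a finite dimensional invariant subspace is meromorphic. -/
theorem meromorphicAt_resolvent_mul {R : ℂ → H →L[ℂ] H} {z₀ : ℂ} (hz₀ : z₀ ≠ w)
    {s P : H →L[ℂ] H} (hs : IsResolventAt A z₀ s) (V : Submodule ℂ H) [FiniteDimensional ℂ V]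
    (hsV : ∀ v ∈ V, s v ∈ V) (hP : ∀ f, P f ∈ V)
    (h : ∀ᶠ z in 𝓝[≠] w, IsResolventAt A z (R z)) : MeromorphicAt (fun z => R z * P) w := by
  obtain ⟨q, hq, hqV⟩ := s.exists_polynomial_sum_eq_zero V hsV
  have hqP : ∑ i ∈ Finset.range (q.natDegree + 1), q.coeff i • (s ^ i * P) = 0 := by
    ext f
    simpa [sum_apply] using hqV (P f) (hP f)
  have hsub : w - z₀ ≠ 0 := sub_ne_zero.2 hz₀.symm
  -- In this variable the resolvent identity reads `R z * (u z • 1 - s) = u z • s`. The polynomial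
  -- `q` kills `s` on `V`, and `c n` is the quotient of `u ^ n - s ^ n` by `u - s`. Hence `q(u) • (R
  -- z * P) = R z * (q(u) - q(s)) * P` is an explicit expression in `s`, analytic in `z`, and it
  -- remains to divide by `q(u)`.
  let u : ℂ → ℂ := fun z => (z - z₀)⁻¹
  have hu : AnalyticAt ℂ u w := AnalyticAt.fun_inv (by fun_prop) hsub
  let c : ℕ → ℂ → H →L[ℂ] H := fun n z => ∑ i ∈ Finset.range n, u z ^ i • s ^ (n - 1 - i)
  have hc : ∀ n, AnalyticAt ℂ (c n) w := fun n => by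
    refine Finset.analyticAt_fun_sum _ fun i _ => ?_
    exact (hu.pow i).smul analyticAt_const
  have hcu : ∀ n z, (u z • 1 - s) * c n z = u z ^ n • 1 - s ^ n := by
    intro n z
    have hcom : Commute (algebraMap ℂ (H →L[ℂ] H) (u z)) s := Algebra.commutes (u z) s
    have := hcom.mul_geom_sum₂ n
    simpa [Algebra.algebraMap_eq_smul_one, smul_pow] using this
  have hQ : AnalyticAt ℂ (fun z => q.eval (u z)) w := by
    simpa using AnalyticAt.aeval_polynomial hu q
  have hsum : AnalyticAt ℂ (fun z => u z •
      ∑ i ∈ Finset.range (q.natDegree + 1), q.coeff i • (s * c i z * P)) w := by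
    refine hu.smul (Finset.analyticAt_fun_sum _ fun i _ => ?_)
    exact ((analyticAt_const.mul (hc i)).mul analyticAt_const).fun_const_smul
  refine (hQ.meromorphicAt.inv.smul hsum.meromorphicAt).congr ?_
  have hq0 : ∀ᶠ z in 𝓝[≠] w, q.eval (u z) ≠ 0 := by
    have hfin : {z | q.eval (u z) = 0}.Finite := by
      have : {x | q.eval x = 0}.Finite := by
        refine (q.rootSet_finite ℂ).subset fun x hx => ?_
        simpa [Polynomial.mem_rootSet, hq] using hx
      refine Finite.preimage (f := u) (fun x _ y _ hxy => ?_) this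
      simpa [u] using hxy
    exact nhdsNE_le_cofinite w hfin.compl_mem_cofinite
  have hne : ∀ᶠ z in 𝓝[≠] w, z ≠ z₀ := nhdsWithin_le_nhds (isOpen_ne.mem_nhds hz₀.symm)
  filter_upwards [h, hq0, hne] with z hz hqz hzz
  have hzz : z - z₀ ≠ 0 := sub_ne_zero.2 hzz
  have h1 : R z * (u z • 1 - s) = u z • s := by
    have h2 := hz.sub_eq hs
    have h3 : R z = s + (z - z₀) • (R z * s) := by
      rw [← sub_eq_iff_eq_add', ← neg_sub s, h2]
      module
    have h4 : u z • R z = u z • s + R z * s := by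
      conv_lhs => rw [h3]
      rw [smul_add, smul_smul, inv_mul_cancel₀ hzz, one_smul]
    rw [mul_sub, mul_smul_comm, mul_one, h4, add_sub_cancel_right]
  change (q.eval (u z))⁻¹ • (u z •
      ∑ i ∈ Finset.range (q.natDegree + 1), q.coeff i • (s * c i z * P)) = R z * P
  rw [inv_smul_eq_iff₀ hqz, Polynomial.eval_eq_sum_range, Finset.sum_smul, Finset.smul_sum,
    ← sub_eq_zero, ← Finset.sum_sub_distrib]
  have h5 : ∀ i, u z • q.coeff i • (s * c i z * P) - (q.coeff i * u z ^ i) • (R z * P) =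
      - (R z * (q.coeff i • (s ^ i * P))) := by
    intro i
    have h6 : u z • (s * c i z) = R z * (u z ^ i • 1 - s ^ i) := by
      rw [← hcu, ← mul_assoc, h1, smul_mul_assoc]
    have h7 : u z • (s * c i z * P) = u z ^ i • (R z * P) - R z * (s ^ i * P) := by
      rw [← smul_mul_assoc, h6, mul_sub, sub_mul, mul_smul_comm, mul_one, smul_mul_assoc, mul_assoc]
    rw [smul_comm, h7, mul_smul_comm, smul_sub, smul_smul]
    abel
  rw [Finset.sum_congr rfl fun i _ => h5 i, Finset.sum_neg_distrib, ← Finset.mul_sum, hqP, mul_zero,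
    neg_zero]

/-- Outside the essential spectrum the resolvent is finitely meromorphic. -/
theorem finitelyMeromorphicAt_resolvent (hw : w ∉ essentialSpectrum A) :
    (∀ᶠ z in 𝓝[≠] w, IsResolventAt A z (resolvent A z)) ∧
      FinitelyMeromorphicAt (resolvent A) w := by
  by_cases hρ : w ∈ resolventSet A
  · obtain ⟨h1, h2⟩ := eventually_mem_resolventSet hρ
    exact ⟨nhdsWithin_le_nhds (h1.mono fun z hz => isResolventAt_resolvent hz),
      h2.finitelyMeromorphicAt⟩
  have hw' : IsIsolatedEigenvalueOfFiniteMultiplicity A w := by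
    by_contra hn
    exact hw ⟨hρ, hn⟩
  obtain ⟨-, r, hr, hball, hfin⟩ := hw'
  have hres : ∀ z ∈ Metric.closedBall w r, z ≠ w → z ∈ resolventSet A := by
    intro z hz hne
    by_contra hn
    have : z ∈ Metric.closedBall w r ∩ spectrum A := ⟨hz, hn⟩
    rw [hball] at this
    exact hne this
  have hev : ∀ᶠ z in 𝓝[≠] w, z ∈ Metric.ball w r ∧ z ≠ w := by
    filter_upwards [nhdsWithin_le_nhds (Metric.ball_mem_nhds w hr), self_mem_nhdsWithin] with z h1 h2
    exact ⟨h1, h2⟩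
  have hR : ∀ᶠ z in 𝓝[≠] w, IsResolventAt A z (resolvent A z) :=
    hev.mono fun z hz => isResolventAt_resolvent (hres z (Metric.ball_subset_closedBall hz.1) hz.2)
  refine ⟨hR, ?_⟩
  have hsph : ∀ z ∈ Metric.sphere w r, z ∈ resolventSet A := fun z hz =>
    hres z (Metric.sphere_subset_closedBall hz) (Metric.ne_of_mem_sphere hz hr.ne')
  have hcont : ContinuousOn (resolvent A) (Metric.sphere w r) := fun z hz =>
    (eventually_mem_resolventSet (hsph z hz)).2.continuousAt.continuousWithinAt
  have hint : CircleIntegrable (resolvent A) w r := hcont.circleIntegrable hr.le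
  set P : H →L[ℂ] H := rieszProjection A w r with hPdef
  have hmul : ∀ T : H →L[ℂ] H, T * P = -(2 * (Real.pi : ℂ) * Complex.I)⁻¹ •
      ∮ z in C(w, r), T * resolvent A z := by
    intro T
    rw [hPdef, rieszProjection, mul_smul_comm]
    congr 1
    exact ((ContinuousLinearMap.mul ℂ _ T).circleIntegral_comp_comm hint).symm
  have hmul' : ∀ T : H →L[ℂ] H, P * T = -(2 * (Real.pi : ℂ) * Complex.I)⁻¹ •
      ∮ z in C(w, r), resolvent A z * T := by
    intro T
    rw [hPdef, rieszProjection, smul_mul_assoc]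
    congr 1
    exact (((ContinuousLinearMap.mul ℂ _).flip T).circleIntegral_comp_comm hint).symm
  have hcomm : ∀ z ∈ resolventSet A, resolvent A z * P = P * resolvent A z := by
    intro z hz
    rw [hmul, hmul', circleIntegral.integral_congr hr.le fun y hy =>
      (isResolventAt_resolvent hz).commute (isResolventAt_resolvent (hsph y hy))]
  have hPmem : ∀ f, P f ∈ P.range := fun f => ⟨f, rfl⟩
  have hinv : ∀ z ∈ resolventSet A, ∀ v ∈ P.range, resolvent A z v ∈ P.range := by
    rintro z hz _ ⟨f, rfl⟩
    exact ⟨resolvent A z f, (congrArg (fun L : H →L[ℂ] H => L f) (hcomm z hz)).symm⟩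
  obtain ⟨z₀, hz₀, hz₀w⟩ := hev.exists
  have hz₀ρ := hres z₀ (Metric.ball_subset_closedBall hz₀) hz₀w
  have hmer : MeromorphicAt (fun z => resolvent A z * P) w :=
    meromorphicAt_resolvent_mul hz₀w (isResolventAt_resolvent hz₀ρ) P.range (hinv z₀ hz₀ρ) hPmem hR
  -- Integrating the resolvent identity in the form `R z * R y = (R y - R z) / (y - z)` over the
  -- circle gives `R z * P = R z - C z`. So the Cauchy integral `C` is the analytic part of the
  -- resolvent, and idempotency of `P` plays no role.
  let C : ℂ → H →L[ℂ] H := fun z => (2 * (Real.pi : ℂ) * Complex.I)⁻¹ •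
    ∮ y in C(w, r), (y - z)⁻¹ • resolvent A y
  have hC : AnalyticAt ℂ C w := by
    lift r to NNReal using hr.le
    exact (hasFPowerSeriesOn_cauchy_integral hint (by exact_mod_cast hr)).analyticAt
  refine ⟨C, fun z => P * resolvent A z, P.range, hfin, hC, hmer.congr ?_,
    fun z f => hPmem _, ?_⟩
  · exact hev.mono fun z hz => hcomm z (hres z (Metric.ball_subset_closedBall hz.1) hz.2)
  filter_upwards [hev] with z ⟨hz, hzw⟩
  have hzρ := hres z (Metric.ball_subset_closedBall hz) hzw
  have hne : ∀ y ∈ Metric.sphere w r, y - z ≠ 0 := fun y hy => by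
    rw [sub_ne_zero]
    rintro rfl
    exact (ne_of_lt hz) hy
  have hinvc : ContinuousOn (fun y : ℂ => (y - z)⁻¹) (Metric.sphere w r) :=
    ContinuousOn.inv₀ (by fun_prop) hne
  have h1 : ∮ y in C(w, r), resolvent A z * resolvent A y =
      ∮ y in C(w, r), ((y - z)⁻¹ • resolvent A y - (y - z)⁻¹ • resolvent A z) := by
    refine circleIntegral.integral_congr hr.le fun y hy => ?_
    have := (isResolventAt_resolvent hzρ).sub_eq (isResolventAt_resolvent (hsph y hy))
    change _ = (y - z)⁻¹ • resolvent A y - (y - z)⁻¹ • resolvent A z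
    rw [← smul_sub, this, inv_smul_smul₀ (hne y hy)]
  have h2 : ∮ y in C(w, r), (y - z)⁻¹ • resolvent A z =
      (2 * (Real.pi : ℂ) * Complex.I) • resolvent A z := by
    rw [circleIntegral.integral_smul_const, circleIntegral.integral_sub_inv_of_mem_ball hz]
  have hi₁ : CircleIntegrable (fun y => (y - z)⁻¹ • resolvent A y) w r :=
    (hinvc.smul hcont).circleIntegrable hr.le
  have hi₂ : CircleIntegrable (fun y => (y - z)⁻¹ • resolvent A z) w r :=
    (hinvc.smul continuousOn_const).circleIntegrable hr.le
  rw [← hcomm z hzρ, hmul, h1, circleIntegral.integral_sub hi₁ hi₂, h2, smul_sub, neg_smul,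
    neg_smul, inv_smul_smul₀ Complex.two_pi_I_ne_zero]
  simp only [C]
  abel

end Laurent

end LinearRelation

/-! ### Difference quotients and continuity in the Herglotz space -/

theorem mem_herglotzDom {h : ℂ → ℂ} (hh : IsHerglotzNevanlinna h) {z : ℂ} (hz : z.im ≠ 0) :
    z ∈ herglotzDom h :=
  ⟨h, hh.analyticOnNhd z hz, Eventually.of_forall fun _ _ => rfl⟩

theorem Complex.eventually_im_ne_zero {z : ℂ} (hz : z.im ≠ 0) : ∀ᶠ y : ℂ in 𝓝 z, y.im ≠ 0 :=
  Complex.continuous_im.continuousAt.eventually_ne hz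

section Extension

variable {D : Set ℂ} (f : D → ℂ)

theorem extendZero_coe (w : D) : extendZero f w = f w :=
  Subtype.val_injective.extend_apply f 0 w

theorem diffQuot_of_ne {w ζ : D} (hne : ζ ≠ w) :
    diffQuot f w ζ = (f ζ - f w) / ((ζ : ℂ) - w) := by
  rw [diffQuot, dslope_of_ne _ (Subtype.coe_injective.ne hne), slope_def_field, extendZero_coe,
    extendZero_coe]

theorem sub_mul_diffQuot (w ζ : D) : ((ζ : ℂ) - w) * diffQuot f w ζ = f ζ - f w := by
  by_cases hne : ζ = w
  · simp [hne]
  · rw [diffQuot_of_ne f hne, mul_div_cancel₀ _ (sub_ne_zero.2 (Subtype.coe_injective.ne hne))]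

end Extension

section HerglotzSpace

variable {h : ℂ → ℂ} {H : Type*} [NormedAddCommGroup H] [InnerProductSpace ℂ H]
  [RKHS ℂ H (herglotzDom h) ℂ]

/-- The point evaluation as a continuous linear functional. -/
noncomputable def evalFunctional (ζ : herglotzDom h) : H →L[ℂ] ℂ :=
  (ContinuousLinearMap.proj ζ).comp (RKHS.coeCLM ℂ)

theorem norm_kerFun_sub_sq [CompleteSpace H] (hH : IsHerglotzSpace h H) (v z : herglotzDom h) :
    ‖RKHS.kerFun H v (1 : ℂ) - RKHS.kerFun H z (1 : ℂ)‖ ^ 2 =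
      ‖nevanlinnaKernel h v v - nevanlinnaKernel h z v - nevanlinnaKernel h v z +
        nevanlinnaKernel h z z‖ := by
  have key : ∀ a b : herglotzDom h, inner ℂ (RKHS.kerFun H a (1 : ℂ)) (RKHS.kerFun H b (1 : ℂ)) =
      nevanlinnaKernel h a b := fun a b => by
    rw [RKHS.kerFun_inner, RKHS.kerFun_apply, hH]
    simp
  have hsq : ∀ x : H, ‖x‖ ^ 2 = ‖inner ℂ x x‖ := fun x => by
    rw [inner_self_eq_norm_sq_to_K]
    simp
  rw [hsq]
  simp only [inner_sub_left, inner_sub_right, key]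
  congr 1
  ring

/-- By the reproducing property and Cauchy–Schwarz, `|f v - f z| ≤ ‖k_v - k_z‖ ‖f‖`, and the squared
norm of `k_v - k_z` is a combination of kernel values that tends to `0` as `v → z`. -/
theorem continuousAt_extendZero [CompleteSpace H] (hh : IsHerglotzNevanlinna h)
    (hH : IsHerglotzSpace h H) (f : H) {z : ℂ} (hz : z.im ≠ 0) :
    ContinuousAt (extendZero (⇑f)) z := by
  have hzD := mem_herglotzDom hh hz
  -- For two points of the same half-plane the derivative branch of the kernel never occurs.
  have hker : ∀ a b : ℂ, 0 < a.im * b.im → nevanlinnaKernel h a b =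
      (h a - conj (h b)) / (a - conj b) := by
    intro a b hab
    have ha : a.im ≠ 0 := left_ne_zero_of_mul hab.ne'
    have hb : b.im ≠ 0 := right_ne_zero_of_mul hab.ne'
    have hne : a ≠ conj b := by
      rintro rfl
      simp only [Complex.conj_im] at hab
      nlinarith [mul_self_nonneg b.im]
    simp [nevanlinnaKernel, hne, herglotzExt, ha, hb]
  let n : ℂ → ℂ → ℂ := fun a b => (h a - conj (h b)) / (a - conj b)
  let M : ℂ → ℂ := fun v => n v v - n z v - n v z + n z z
  have hhc : ContinuousAt h z := (hh.analyticOnNhd z hz).continuousAt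
  have hcc : ContinuousAt (fun v => conj (h v)) z := Complex.continuous_conj.continuousAt.comp hhc
  have hc : ContinuousAt (fun v : ℂ => conj v) z := Complex.continuous_conj.continuousAt
  have hd : z - conj z ≠ 0 := by
    rw [sub_ne_zero]
    intro he
    have := congrArg Complex.im he
    rw [Complex.conj_im] at this
    exact hz (by linarith)
  have hM : ContinuousAt M z := by
    have h1 : ContinuousAt (fun v => n v v) z := (hhc.sub hcc).div (continuousAt_id.sub hc) hd
    have h2 : ContinuousAt (fun v => n z v) z :=
      (continuousAt_const.sub hcc).div (continuousAt_const.sub hc) hd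
    have h3 : ContinuousAt (fun v => n v z) z :=
      (hhc.sub continuousAt_const).div (continuousAt_id.sub continuousAt_const) hd
    exact ((h1.sub h2).sub h3).add continuousAt_const
  have hM0 : M z = 0 := by simp [M]
  have hpos : ∀ᶠ v : ℂ in 𝓝 z, 0 < v.im * z.im := by
    have hcont : ContinuousAt (fun v : ℂ => v.im * z.im) z := by fun_prop
    exact hcont.eventually (lt_mem_nhds (mul_self_pos.2 hz))
  rw [ContinuousAt, tendsto_iff_norm_sub_tendsto_zero]
  have hlim : Tendsto (fun v => √‖M v‖ * ‖f‖) (𝓝 z) (𝓝 0) := by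
    have : Tendsto (fun v => √‖M v‖ * ‖f‖) (𝓝 z) (𝓝 (√‖M z‖ * ‖f‖)) :=
      hM.norm.sqrt.mul continuousAt_const
    simpa [hM0] using this
  refine squeeze_zero' (Eventually.of_forall fun _ => norm_nonneg _) ?_ hlim
  filter_upwards [hpos, Complex.eventually_im_ne_zero hz] with v hv hv0
  have hvD := mem_herglotzDom hh hv0
  have h1 : extendZero (⇑f) v - extendZero (⇑f) z =
      inner ℂ (RKHS.kerFun H ⟨v, hvD⟩ (1 : ℂ) - RKHS.kerFun H ⟨z, hzD⟩ (1 : ℂ)) f := by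
    rw [inner_sub_left, RKHS.kerFun_inner, RKHS.kerFun_inner, extendZero_coe (⇑f) ⟨v, hvD⟩,
      extendZero_coe (⇑f) ⟨z, hzD⟩]
    simp
  have h2 : ‖RKHS.kerFun H ⟨v, hvD⟩ (1 : ℂ) - RKHS.kerFun H ⟨z, hzD⟩ (1 : ℂ)‖ = √‖M v‖ := by
    rw [← Real.sqrt_sq (norm_nonneg (RKHS.kerFun H ⟨v, hvD⟩ (1 : ℂ) - _)), norm_kerFun_sub_sq hH]
    simp only [M, n]
    rw [hker v v (mul_self_pos.2 hv0), hker z v (by rwa [mul_comm]), hker v z hv,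
      hker z z (mul_self_pos.2 hz)]
  rw [h1, ← h2]
  exact norm_inner_le_norm _ _

/-- Evaluation at `ζ = z` shows that the constant is `f z`. Leaving out `ζ = z` on the right avoids
the derivative in `D_z f`. -/
theorem mem_selfAdjointRelation_iff (f x : H) (z : herglotzDom h) :
    (x, f + (z : ℂ) • x) ∈ selfAdjointRelation h H ↔
      ∀ ζ, ζ ≠ z → x ζ = (f ζ - f z) / ((ζ : ℂ) - z) := by
  have hval : ∀ ζ : herglotzDom h, (f + (z : ℂ) • x) ζ - (ζ : ℂ) * x ζ =
      f ζ - ((ζ : ℂ) - z) * x ζ := fun ζ => by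
    simp
    ring
  constructor
  · rintro ⟨c, hc⟩ ζ hne
    have hc' : ∀ ζ : herglotzDom h, f ζ - ((ζ : ℂ) - z) * x ζ = c := fun ζ => by
      rw [← hval]
      exact hc ζ
    have h1 := hc' z
    rw [sub_self, zero_mul, sub_zero] at h1
    rw [eq_div_iff (sub_ne_zero.2 (Subtype.coe_injective.ne hne)), h1]
    linear_combination -hc' ζ
  · intro hx
    refine ⟨f z, fun ζ => (hval ζ).trans ?_⟩
    by_cases hne : ζ = z
    · simp [hne]
    · rw [hx ζ hne, mul_div_cancel₀ _ (sub_ne_zero.2 (Subtype.coe_injective.ne hne)), sub_sub_cancel]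

theorem isClosed_selfAdjointRelation (hh : IsHerglotzNevanlinna h) :
    IsClosed (selfAdjointRelation h H : Set (H × H)) := by
  let ζ₀ : herglotzDom h := ⟨Complex.I, mem_herglotzDom hh (by simp)⟩
  have he : (selfAdjointRelation h H : Set (H × H)) = ⋂ ζ : herglotzDom h,
      {p | p.2 ζ - (ζ : ℂ) * p.1 ζ = p.2 ζ₀ - (ζ₀ : ℂ) * p.1 ζ₀} := by
    ext p
    rw [mem_iInter]
    constructor
    · rintro ⟨c, hc⟩ ζ
      exact (hc ζ).trans (hc ζ₀).symm
    · exact fun hp => ⟨_, hp⟩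
  have hc : ∀ ζ : herglotzDom h, Continuous fun p : H × H => p.2 ζ - (ζ : ℂ) * p.1 ζ := fun ζ =>
    ((RKHS.continuous_eval ζ).comp continuous_snd).sub
      (continuous_const.mul ((RKHS.continuous_eval ζ).comp continuous_fst))
  rw [he]
  exact isClosed_iInter fun ζ => isClosed_eq (hc ζ) (hc ζ₀)

variable [CompleteSpace H]

/-- Near a nonreal point the value of an element of the Herglotz space at that point is determined
by the other values. -/
theorem tendsto_extendZero (hh : IsHerglotzNevanlinna h) (hH : IsHerglotzSpace h H) (f : H)
    {z : herglotzDom h} (hz : (z : ℂ).im ≠ 0) :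
    Tendsto (extendZero (⇑f)) (𝓝[≠] (z : ℂ)) (𝓝 (f z)) := by
  have := (continuousAt_extendZero hh hH f hz).tendsto
  rw [extendZero_coe] at this
  exact this.mono_left nhdsWithin_le_nhds

/-- Thanks to continuity, all resolvent formulas below need checking only at `ζ ≠ z`. -/
theorem eq_of_eq_off_point (hh : IsHerglotzNevanlinna h) (hH : IsHerglotzSpace h H) {x y : H}
    {z : herglotzDom h} (hz : (z : ℂ).im ≠ 0) (hxy : ∀ ζ, ζ ≠ z → x ζ = y ζ) : x = y := by
  ext ζ
  by_cases hne : ζ = z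
  · subst hne
    refine tendsto_nhds_unique (tendsto_extendZero hh hH x hz)
      ((tendsto_extendZero hh hH y hz).congr' ?_)
    filter_upwards [nhdsWithin_le_nhds (Complex.eventually_im_ne_zero hz), self_mem_nhdsWithin]
      with v hv hne
    have hvD := mem_herglotzDom hh hv
    rw [extendZero_coe (⇑x) ⟨v, hvD⟩, extendZero_coe (⇑y) ⟨v, hvD⟩]
    exact (hxy ⟨v, hvD⟩ fun he => hne (congrArg Subtype.val he)).symm
  · exact hxy ζ hne

theorem isResolventAt_selfAdjointRelation_iff (hh : IsHerglotzNevanlinna h)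
    (hH : IsHerglotzSpace h H) {z : herglotzDom h} (hz : (z : ℂ).im ≠ 0) {T : H →L[ℂ] H} :
    LinearRelation.IsResolventAt (selfAdjointRelation h H) z T ↔
      ∀ f ζ, ζ ≠ z → T f ζ = (f ζ - f z) / ((ζ : ℂ) - z) := by
  constructor
  · exact fun hT f => (mem_selfAdjointRelation_iff f (T f) z).1 (hT.mem f)
  · intro hT f x
    rw [mem_selfAdjointRelation_iff]
    constructor
    · exact fun hx => eq_of_eq_off_point hh hH hz fun ζ hne => (hx ζ hne).trans (hT f ζ hne).symm
    · rintro rfl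
      exact hT f

end HerglotzSpace

/-! ### The rank one perturbation -/

section MeromorphicOperators

variable {E F : Type*} [NormedAddCommGroup E] [NormedSpace ℂ E] [NormedAddCommGroup F]
  [NormedSpace ℂ F] {w : ℂ}

theorem MeromorphicAt.add_sub_smul {u : ℂ → F} (hu : MeromorphicAt u w) (x : F) (c : ℂ) :
    MeromorphicAt (fun z => x + (z - c) • u z) w := by
  have h1 : MeromorphicAt (fun z : ℂ => z - c) w := by fun_prop
  exact (MeromorphicAt.const x w).add (h1.smul hu)

theorem MeromorphicAt.sub_sub_smul {u : ℂ → F} (hu : MeromorphicAt u w) (x : F) (c : ℂ) :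
    MeromorphicAt (fun z => x - (c - z) • u z) w := by
  have h1 : MeromorphicAt (fun z : ℂ => c - z) w := by fun_prop
  exact (MeromorphicAt.const x w).sub (h1.smul hu)

theorem MeromorphicAt.apply_const {R : ℂ → E →L[ℂ] F} (hR : MeromorphicAt R w) (x : E) :
    MeromorphicAt (fun z => R z x) w :=
  (ContinuousLinearMap.apply ℂ F x).comp_meromorphicAt hR

theorem MeromorphicAt.const_comp {R : ℂ → E →L[ℂ] E} (hR : MeromorphicAt R w) (L : E →L[ℂ] F) :
    MeromorphicAt (fun z => L.comp (R z)) w :=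
  (ContinuousLinearMap.compL ℂ E E F L).comp_meromorphicAt hR

end MeromorphicOperators

section Perturbation

variable {h : ℂ → ℂ} {H : Type*} [NormedAddCommGroup H] [InnerProductSpace ℂ H]
  [RKHS ℂ H (herglotzDom h) ℂ] {g : herglotzDom h → ℂ} {A : Submodule ℂ (H × H)}

theorem IsDefinedBy.resolvent_apply (hAg : IsDefinedBy A g) {z : herglotzDom h} (hgz : g z ≠ 0)
    (f : H) {ζ : herglotzDom h} (hne : ζ ≠ z) :
    LinearRelation.resolvent A z f ζ = (f ζ - f z / g z * g ζ) / ((ζ : ℂ) - z) := by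
  have h1 : ((ζ : ℂ) - z) ≠ 0 := sub_ne_zero.2 (Subtype.coe_injective.ne hne)
  rw [(hAg z hgz).2 f, Pi.sub_apply, Pi.smul_apply, smul_eq_mul, diffQuot_of_ne _ hne,
    diffQuot_of_ne _ hne]
  field_simp
  ring

variable [CompleteSpace H]

/-- The zeros of `g` are eigenvalues of the extension defined by `g`. -/
theorem IsDefinedBy.ne_zero_of_mem_resolventSet (hh : IsHerglotzNevanlinna h)
    (hH : IsHerglotzSpace h H) (hg : g ∈ quasiHerglotzSpace h H) (hAg : IsDefinedBy A g)
    {z₀ : herglotzDom h} (hz₀ : (z₀ : ℂ).im ≠ 0) (hgz₀ : g z₀ ≠ 0) {w : herglotzDom h}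
    (hw : (w : ℂ) ∈ LinearRelation.resolventSet A) : g w ≠ 0 := by
  intro hgw
  have hne : z₀ ≠ w := fun he => hgz₀ (he ▸ hgw)
  have hne' : (z₀ : ℂ) - w ≠ 0 := sub_ne_zero.2 (Subtype.coe_injective.ne hne)
  obtain ⟨F, hF⟩ := hg.2 w
  have hFg : ∀ ζ : herglotzDom h, ((ζ : ℂ) - w) * F ζ = g ζ := fun ζ => by
    rw [hF, sub_mul_diffQuot, hgw, sub_zero]
  have hres := LinearRelation.isResolventAt_resolvent (hAg z₀ hgz₀).1
  -- As `g w = 0`, the function `F = D_w g` is `g / (· - w)`. This identity says that `F` solves the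
  -- eigenvalue equation at `w`; since `w` is a resolvent point, `F = 0`, against `g z₀ ≠ 0`.
  have hFT : F = LinearRelation.resolvent A z₀ (((w : ℂ) - z₀) • F) := by
    refine eq_of_eq_off_point hh hH hz₀ fun ζ hζ => ?_
    have hζ' : (ζ : ℂ) - z₀ ≠ 0 := sub_ne_zero.2 (Subtype.coe_injective.ne hζ)
    rw [hAg.resolvent_apply hgz₀ _ hζ, eq_div_iff hζ']
    have h1 : (((w : ℂ) - z₀) • F) z₀ / g z₀ = -1 := by
      rw [div_eq_iff hgz₀, ← hFg z₀, RKHS.coe_smul, Pi.smul_apply, smul_eq_mul]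
      ring
    rw [h1, ← hFg ζ, RKHS.coe_smul, Pi.smul_apply, smul_eq_mul]
    ring
  have hmem : (F, (0 : H) + (w : ℂ) • F) ∈ A := by
    have := (hres _ F).2 hFT
    convert this using 2
    module
  have hF0 : F = 0 := by
    rw [(LinearRelation.isResolventAt_resolvent hw 0 F).1 hmem, map_zero]
  have := hFg z₀
  rw [hF0] at this
  exact hgz₀ (by simpa using this.symm)

/-- With `R` the resolvent of `A_h` and `G = D_{z₀} g`, at nonreal `z` near `w` one has `f z = f z₀
- (z₀ - z) (R z f) z₀`, `g z = g z₀ + (z - z₀) G z` and `D_z g = G + (z - z₀) R z G`. These are `φ`,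
`γ` and `u`, meromorphic at `w` because `R` is. -/
theorem IsDefinedBy.notMem_essentialSpectrum (hh : IsHerglotzNevanlinna h)
    (hH : IsHerglotzSpace h H) (hg : g ∈ quasiHerglotzSpace h H) (hAg : IsDefinedBy A g)
    (hA : IsClosed (A : Set (H × H))) (z₀ : herglotzDom h) {w : ℂ}
    (hfreq : ∃ᶠ z in 𝓝[≠] w, z.im ≠ 0 ∧ extendZero g z ≠ 0)
    (hw : w ∉ LinearRelation.essentialSpectrum (selfAdjointRelation h H)) :
    w ∉ LinearRelation.essentialSpectrum A := by
  obtain ⟨hres, hR⟩ := LinearRelation.finitelyMeromorphicAt_resolvent hw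
  set R := LinearRelation.resolvent (selfAdjointRelation h H) with hRdef
  obtain ⟨G, hG⟩ := hg.2 z₀
  have hGg : ∀ ζ : herglotzDom h, ((ζ : ℂ) - z₀) * G ζ = g ζ - g z₀ := fun ζ => by rw [hG, sub_mul_diffQuot]
  have hRm := hR.meromorphicAt
  let φ : ℂ → H →L[ℂ] ℂ := fun z =>
    evalFunctional z₀ - ((z₀ : ℂ) - z) • (evalFunctional z₀).comp (R z)
  let γ : ℂ → ℂ := fun z => g z₀ + (z - z₀) • φ z G
  let u : ℂ → H := fun z => G + (z - z₀) • R z G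
  have hφ : MeromorphicAt φ w := (hRm.const_comp _).sub_sub_smul _ _
  have hγ : MeromorphicAt γ w := (hφ.apply_const G).add_sub_smul _ _
  have hu : MeromorphicAt u w := (hRm.apply_const G).add_sub_smul _ _
  have hval : ∀ᶠ z in 𝓝[≠] w, ∀ hz : z.im ≠ 0,
      (∀ f : H, φ z f = f ⟨z, mem_herglotzDom hh hz⟩) ∧ γ z = g ⟨z, mem_herglotzDom hh hz⟩ ∧
        ∀ ζ : herglotzDom h, (ζ : ℂ) ≠ z →
          u z ζ = (g ζ - g ⟨z, mem_herglotzDom hh hz⟩) / ((ζ : ℂ) - z) := by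
    filter_upwards [hres] with z hresz hz
    set z' : herglotzDom h := ⟨z, mem_herglotzDom hh hz⟩
    have hT := (isResolventAt_selfAdjointRelation_iff hh hH (z := z') hz).1 hresz
    have h1 : ∀ f : H, φ z f = f z' := by
      intro f
      change f z₀ - ((z₀ : ℂ) - z) * R z f z₀ = f z'
      by_cases he : z₀ = z'
      · rw [he]
        simp [z']
      · rw [hT f z₀ he, mul_div_cancel₀ _ (sub_ne_zero.2 (Subtype.coe_injective.ne he)),
          sub_sub_cancel]
    have h2 : γ z = g z' := by
      change g z₀ + (z - z₀) * φ z G = g z'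
      rw [h1]
      linear_combination hGg z'
    refine ⟨h1, h2, fun ζ hζ => ?_⟩
    have hζz : (ζ : ℂ) - z ≠ 0 := sub_ne_zero.2 hζ
    change (G + (z - z₀) • R z G) ζ = _
    rw [RKHS.coe_add, RKHS.coe_smul, Pi.add_apply, Pi.smul_apply, smul_eq_mul,
      hT G ζ fun he => hζ (congrArg Subtype.val he)]
    change G ζ + (z - z₀) * ((G ζ - G z') / ((ζ : ℂ) - z)) = _
    rw [eq_div_iff hζz, add_mul, mul_assoc, div_mul_cancel₀ _ hζz]
    linear_combination hGg ζ - hGg z'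
  -- A meromorphic function vanishes identically or nowhere in a punctured neighbourhood; `hfreq`
  -- rules out the former.
  have hγ0 : ∀ᶠ z in 𝓝[≠] w, γ z ≠ 0 := by
    refine hγ.eventually_eq_zero_or_eventually_ne_zero.resolve_left fun h0 => ?_
    refine hfreq ?_
    filter_upwards [h0, hval] with z hz1 hz2 ⟨hz3, hz4⟩
    rw [(hz2 hz3).2.1] at hz1
    exact hz4 ((extendZero_coe g ⟨z, _⟩).trans hz1)
  refine LinearRelation.notMem_essentialSpectrum hA
    (R := fun z => R z + (-(γ z)⁻¹ • φ z).smulRight (u z))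
    (hR.add (FinitelyMeromorphicAt.smulRight (hγ.inv.neg.smul hφ) hu)) ?_
  filter_upwards [hγ0, hval, hres] with z hz1 hz2 hresz hz
  obtain ⟨h1, h2, h3⟩ := hz2 hz
  set z' : herglotzDom h := ⟨z, mem_herglotzDom hh hz⟩
  have hgz : g z' ≠ 0 := h2 ▸ hz1
  have hT := (isResolventAt_selfAdjointRelation_iff hh hH (z := z') hz).1 hresz
  convert LinearRelation.isResolventAt_resolvent (hAg z' hgz).1 using 1
  ext1 f
  refine eq_of_eq_off_point hh hH (z := z') hz fun ζ hζ => ?_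
  have hζz : (ζ : ℂ) - z ≠ 0 := sub_ne_zero.2 (Subtype.coe_injective.ne hζ)
  rw [hAg.resolvent_apply hgz f hζ]
  change (R z f + (-(γ z)⁻¹ * φ z f) • u z) ζ = _
  rw [RKHS.coe_add, RKHS.coe_smul, Pi.add_apply, Pi.smul_apply, smul_eq_mul, hT f ζ hζ,
    h3 ζ (sub_ne_zero.1 hζz), h1, h2]
  change (f ζ - f z') / ((ζ : ℂ) - z) + -(g z')⁻¹ * f z' * ((g ζ - g z') / ((ζ : ℂ) - z)) =
    (f ζ - f z' / g z' * g ζ) / ((ζ : ℂ) - z)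
  field_simp
  ring

/-- Now `R` is the resolvent of `A`, and evaluating `R z f` at `z₀` yields `f z / g z`. Accordingly
`ψ z f = f z / g z`, `κ z = 1 / g z` and `v z = D_z g / g z`, and the correction `(f z / g z) D_z g`
equals `(κ z)⁻¹ ψ z f • v z`. No nonvanishing hypothesis near `w` is needed, since `g` has no zeros
in the resolvent set of `A`. -/
theorem IsDefinedBy.notMem_essentialSpectrum_selfAdjointRelation (hh : IsHerglotzNevanlinna h)
    (hH : IsHerglotzSpace h H) (hg : g ∈ quasiHerglotzSpace h H) (hAg : IsDefinedBy A g)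
    {z₀ : herglotzDom h} (hz₀ : (z₀ : ℂ).im ≠ 0) (hgz₀ : g z₀ ≠ 0) {w : ℂ}
    (hw : w ∉ LinearRelation.essentialSpectrum A) :
    w ∉ LinearRelation.essentialSpectrum (selfAdjointRelation h H) := by
  obtain ⟨hres, hR⟩ := LinearRelation.finitelyMeromorphicAt_resolvent hw
  set R := LinearRelation.resolvent A with hRdef
  obtain ⟨G, hG⟩ := hg.2 z₀
  have hGg : ∀ ζ : herglotzDom h, ((ζ : ℂ) - z₀) * G ζ = g ζ - g z₀ := fun ζ => by rw [hG, sub_mul_diffQuot]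
  have hRm := hR.meromorphicAt
  let ψ : ℂ → H →L[ℂ] ℂ := fun z =>
    (g z₀)⁻¹ • (evalFunctional z₀ - ((z₀ : ℂ) - z) • (evalFunctional z₀).comp (R z))
  let κ : ℂ → ℂ := fun z => (g z₀)⁻¹ * (1 + (z - z₀) • -ψ z G)
  let v : ℂ → H := fun z => (g z₀)⁻¹ • (G + (z - z₀) • R z G)
  have hψ : MeromorphicAt ψ w := ((hRm.const_comp _).sub_sub_smul _ _).fun_const_smul _
  have hκ : MeromorphicAt κ w :=
    (MeromorphicAt.const _ w).mul ((hψ.apply_const G).neg.add_sub_smul 1 _)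
  have hv : MeromorphicAt v w := ((hRm.apply_const G).add_sub_smul _ _).fun_const_smul _
  refine LinearRelation.notMem_essentialSpectrum (isClosed_selfAdjointRelation hh)
    (R := fun z => R z + ((κ z)⁻¹ • ψ z).smulRight (v z))
    (hR.add (FinitelyMeromorphicAt.smulRight (hκ.inv.smul hψ) hv)) ?_
  filter_upwards [hres] with z hresz hz
  set z' : herglotzDom h := ⟨z, mem_herglotzDom hh hz⟩
  have hgz : g z' ≠ 0 :=
    hAg.ne_zero_of_mem_resolventSet hh hH hg hz₀ hgz₀ (w := z') hresz.mem_resolventSet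
  have hT : ∀ (f : H) (ζ : herglotzDom h), ζ ≠ z' →
      R z f ζ = (f ζ - f z' / g z' * g ζ) / ((ζ : ℂ) - z) := fun f ζ hζ =>
    hAg.resolvent_apply hgz f hζ
  have h1 : ∀ f : H, ψ z f = f z' / g z' := by
    intro f
    change (g z₀)⁻¹ * (f z₀ - ((z₀ : ℂ) - z) * R z f z₀) = f z' / g z'
    rw [inv_mul_eq_iff_eq_mul₀ hgz₀]
    by_cases he : z₀ = z'
    · rw [he]
      simp only [z', sub_self, zero_mul, sub_zero]
      rw [mul_div_cancel₀ _ hgz]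
    · rw [hT f z₀ he, mul_div_cancel₀ _ (sub_ne_zero.2 (Subtype.coe_injective.ne he)),
        sub_sub_cancel, mul_comm]
  have h2 : κ z = (g z')⁻¹ := by
    change (g z₀)⁻¹ * (1 + (z - z₀) * -ψ z G) = (g z')⁻¹
    rw [h1]
    have := hGg z'
    change (z - z₀) * G z' = g z' - g z₀ at this
    field_simp
    linear_combination -this
  have h3 : ∀ ζ : herglotzDom h, ζ ≠ z' → v z ζ = (g ζ - g z') / ((ζ : ℂ) - z) / g z' := by
    intro ζ hζ
    have hζz : (ζ : ℂ) - z ≠ 0 := sub_ne_zero.2 (Subtype.coe_injective.ne hζ)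
    change ((g z₀)⁻¹ • (G + (z - z₀) • R z G)) ζ = _
    rw [RKHS.coe_smul, RKHS.coe_add, RKHS.coe_smul, Pi.smul_apply, Pi.add_apply, Pi.smul_apply,
      smul_eq_mul, smul_eq_mul, hT G ζ hζ]
    have e1 := hGg ζ
    have e2 : (z - z₀) * G z' = g z' - g z₀ := hGg z'
    field_simp
    linear_combination g z' * e1 - g ζ * e2
  refine (isResolventAt_selfAdjointRelation_iff hh hH (z := z') hz).2 fun f ζ hζ => ?_
  have hζz : (ζ : ℂ) - z ≠ 0 := sub_ne_zero.2 (Subtype.coe_injective.ne hζ)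
  change (R z f + ((κ z)⁻¹ * ψ z f) • v z) ζ = (f ζ - f z') / ((ζ : ℂ) - z)
  rw [RKHS.coe_add, RKHS.coe_smul, Pi.add_apply, Pi.smul_apply, smul_eq_mul, hT f ζ hζ, h3 ζ hζ,
    h1, h2]
  field_simp
  ring

end Perturbation

/-! ### Identity theorem and conclusion -/

section Main

/-- An analytic function on a connected open set that does not vanish identically is nonzero
arbitrarily close to every point of the closure. -/
theorem AnalyticOnNhd.frequently_ne_zero {f : ℂ → ℂ} {U : Set ℂ} (hf : AnalyticOnNhd ℂ f U)
    (hU : IsOpen U) (hUc : IsPreconnected U) {z w : ℂ} (hz : z ∈ U) (hfz : f z ≠ 0)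
    (hw : w ∈ closure U) : ∃ᶠ y in 𝓝[≠] w, y ∈ U ∧ f y ≠ 0 := by
  have key : ∀ y ∈ U, ¬ ∀ᶠ x in 𝓝[≠] y, x ∈ U → f x = 0 := by
    intro y hy h0
    have h1 : ∀ᶠ x in 𝓝[≠] y, f x = 0 := by
      filter_upwards [h0, nhdsWithin_le_nhds (hU.mem_nhds hy)] with x hx hxU using hx hxU
    exact hfz (hf.eqOn_zero_of_preconnected_of_frequently_eq_zero hUc hy h1.frequently hz)
  intro h0
  have h0 : ∀ᶠ y in 𝓝[≠] w, y ∈ U → f y = 0 := by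
    filter_upwards [h0] with y hy hyU
    by_contra hn
    exact hy ⟨hyU, hn⟩
  by_cases hwU : w ∈ U
  · exact key w hwU h0
  -- At a boundary point, vanishing on `U` near `w` forces vanishing near some `y ∈ U` close to `w`,
  -- where the identity theorem applies.
  · have h1 := eventually_eventually_nhdsWithin.2 h0
    rw [eventually_nhdsWithin_iff] at h1
    obtain ⟨y, hyU, hy⟩ := (mem_closure_iff_frequently.1 hw).and_eventually h1 |>.exists
    have hne : y ∈ ({w}ᶜ : Set ℂ) := by
      rintro rfl
      exact hwU hyU
    have h2 := hy hne
    rw [IsOpen.nhdsWithin_eq isOpen_compl_singleton hne] at h2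
    exact key y hyU (nhdsWithin_le_nhds h2)

variable {h : ℂ → ℂ} {g : herglotzDom h → ℂ}

theorem exists_ne_zero_of_ne_zero (hh : IsHerglotzNevanlinna h)
    (hg : AnalyticOnNhd ℂ (extendZero g) (herglotzDom h)) (hg0 : g ≠ 0) :
    ∃ z : herglotzDom h, (z : ℂ).im ≠ 0 ∧ g z ≠ 0 := by
  obtain ⟨w, hw⟩ := Function.ne_iff.1 hg0
  have h1 : ∀ᶠ z in 𝓝 (w : ℂ), extendZero g z ≠ 0 := by
    refine (hg w w.2).continuousAt.eventually_ne ?_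
    rwa [extendZero_coe]
  obtain ⟨z, hz, hgz⟩ :=
    (mem_closure_iff_frequently.1 (Complex.dense_im_ne_zero (w : ℂ))).and_eventually h1 |>.exists
  rw [extendZero_coe g ⟨z, mem_herglotzDom hh hz⟩] at hgz
  exact ⟨⟨z, mem_herglotzDom hh hz⟩, hz, hgz⟩

/-- Real points lie in the closure of both half-planes, so one nonzero value in either half-plane
serves all of them; a nonreal `w` needs one in its own half-plane. -/
theorem frequently_extendZero_ne_zero (hh : IsHerglotzNevanlinna h)
    (hg : AnalyticOnNhd ℂ (extendZero g) (herglotzDom h)) {z : herglotzDom h}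
    (hgz : g z ≠ 0) {w : ℂ} (hw : 0 < (z : ℂ).im ∧ 0 ≤ w.im ∨ (z : ℂ).im < 0 ∧ w.im ≤ 0) :
    ∃ᶠ y in 𝓝[≠] w, y.im ≠ 0 ∧ extendZero g y ≠ 0 := by
  rw [← extendZero_coe g] at hgz
  rcases hw with ⟨hz, hw⟩ | ⟨hz, hw⟩
  · have hU : {y : ℂ | 0 < y.im} ⊆ {y | y.im ≠ 0} := fun y hy => ne_of_gt hy
    refine (AnalyticOnNhd.frequently_ne_zero (hg.mono fun y hy => mem_herglotzDom hh (hU hy))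
      (isOpen_lt continuous_const Complex.continuous_im) (convex_halfSpace_im_gt 0).isPreconnected
      hz hgz ?_).mono fun y hy => ⟨hU hy.1, hy.2⟩
    rw [Complex.closure_setOfPred_lt_im]
    exact hw
  · have hU : {y : ℂ | y.im < 0} ⊆ {y | y.im ≠ 0} := fun y hy => ne_of_lt hy
    refine (AnalyticOnNhd.frequently_ne_zero (hg.mono fun y hy => mem_herglotzDom hh (hU hy))
      (isOpen_lt Complex.continuous_im continuous_const) (convex_halfSpace_im_lt 0).isPreconnected
      hz hgz ?_).mono fun y hy => ⟨hU hy.1, hy.2⟩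
    rw [Complex.closure_setOfPred_im_lt]
    exact hw

end Main

theorem mainTheorem6 (h : ℂ → ℂ) (hh : IsHerglotzNevanlinna h)
    {H : Type*} [NormedAddCommGroup H] [InnerProductSpace ℂ H] [CompleteSpace H]
    [RKHS ℂ H (herglotzDom h) ℂ] (hH : IsHerglotzSpace h H)
    (g : herglotzDom h → ℂ) (hg : g ∈ quasiHerglotzSpace h H) (hg0 : g ≠ 0)
    (A : Submodule ℂ (H × H))
    (hA : LinearRelation.IsRegularExtension (mulRelation h H) A)
    (hAg : IsDefinedBy A g) :
    LinearRelation.essentialSpectrum (selfAdjointRelation h H) ∩ Set.range ((↑) : ℝ → ℂ) =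
        LinearRelation.essentialSpectrum A ∩ Set.range ((↑) : ℝ → ℂ) ∧
      ((∃ z : herglotzDom h, 0 < (z : ℂ).im ∧ g z ≠ 0) →
        (∃ z : herglotzDom h, (z : ℂ).im < 0 ∧ g z ≠ 0) →
        LinearRelation.essentialSpectrum (selfAdjointRelation h H) =
          LinearRelation.essentialSpectrum A) := by
  obtain ⟨z₀, hz₀, hgz₀⟩ := exists_ne_zero_of_ne_zero hh hg.1 hg0
  have key : ∀ w : ℂ, (∃ᶠ z in 𝓝[≠] w, z.im ≠ 0 ∧ extendZero g z ≠ 0) →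
      (w ∈ LinearRelation.essentialSpectrum (selfAdjointRelation h H) ↔
        w ∈ LinearRelation.essentialSpectrum A) := fun w hw =>
    not_iff_not.1 ⟨hAg.notMem_essentialSpectrum hh hH hg hA.isClosed z₀ hw,
      hAg.notMem_essentialSpectrum_selfAdjointRelation hh hH hg hz₀ hgz₀⟩
  constructor
  · ext w
    refine and_congr_left ?_
    rintro ⟨x, rfl⟩
    refine key _ (frequently_extendZero_ne_zero hh hg.1 hgz₀ ?_)
    rcases lt_or_gt_of_ne hz₀ with hlt | hgt
    · exact Or.inr ⟨hlt, by simp⟩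
    · exact Or.inl ⟨hgt, by simp⟩
  · rintro ⟨z₁, hz₁, hgz₁⟩ ⟨z₂, hz₂, hgz₂⟩
    ext w
    refine key w ?_
    rcases le_total 0 w.im with hw | hw
    · exact frequently_extendZero_ne_zero hh hg.1 hgz₁ (Or.inl ⟨hz₁, hw⟩)
    · exact frequently_extendZero_ne_zero hh hg.1 hgz₂ (Or.inr ⟨hz₂, hw⟩)
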